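/- Work in a countably saturated nonstandard extension $X\mapsto {}^*X$ of the universe of sets, and fix an infinite $K\in{}^*\mathbb N$. Let $2^K$ be the internal set of hyperfinite $0$–$1$ sequences of length $K$, equipped with the internal product measure $\mu$ (the nonstandard extension, at $K$, of $n\mapsto$ the $n$-fold product of the uniform probability measure on $\{0,1\}$), and let $m$ be Lebesgue measure on $2^{\mathbb N}$, that is, the infinite product of the uniform probability measure on $\{0,1\}$. Let $f:2^K\to 2^{\mathbb N}$ be the map that restricts a hyperfinite sequence to its initial segment indexed by the standard natural numbers. There is exactly one measure $\mu_L$ (the Loeb measure of $\mu$) on the $\sigma$-algebra generated by the internal subsets of $2^K$ such that $\mu_L(A)=\operatorname{st}(\mu(A))$ for every internal $A\subseteq 2^K$. It is a probability measure, $f$ is measurable, and the pushforward of $\mu_L$ along $f$ is precisely $m$. Consequently, if $E\subseteq 2^{\mathbb N}$ is any $m$-null set, then $\mu_L(f^{-1}(E))=0$, i.e. $f(x)\notin E$ for $\mu_L$-almost every $x\in 2^K$. In particular, every countable set $E\subseteq 2^{\mathbb N}$ is $m$-null, so $f(x)\notin E$ for $\mu_L$-almost every $x$. For instance, the set of computable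 sequences is countable, so $f(x)$ is not computable for $\mu_L$-almost every $x$; and the set of sequences that are not Martin-Löf random (with respect to $m$) is $m$-null, so $f(x)$ is Martin-Löf random for $\mu_L$-almost every $x$. -/

import Mathlib

open MeasureTheory Set

universe u

/-- A nonstandard extension of the universe of sets: every set `X` is extended to a set `*X`, every
function to a function, every subset to a subset, in such a way that Boolean combinations,
equality, ordered pairs and existential quantification (images) are preserved.
By induction on formulas these clauses give the transfer principle for all first-order statements
about standard sets, functions and relations; conversely each clause is an instance of transfer. -/
structure NonstandardExtension where
  /-- the extension `*X` of `X` -/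
  Star : Type → Type u
  /-- the inclusion of `X` in `*X` -/
  std : ∀ {X : Type}, X → Star X
  /-- the extension `*f` of a function `f` -/
  map : ∀ {X Y : Type}, (X → Y) → Star X → Star Y
  /-- the extension `*A ⊆ *X` of a subset `A ⊆ X` -/
  lift : ∀ {X : Type}, Set X → Set (Star X)
  map_std : ∀ {X Y : Type} (f : X → Y) (x : X), map f (std x) = std (f x)
  map_id : ∀ {X : Type} (x : Star X), map id x = x
  map_comp : ∀ {X Y Z : Type} (g : Y → Z) (f : X → Y) (x : Star X),
    map (g ∘ f) x = map g (map f x)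
  lift_compl : ∀ {X : Type} (A : Set X), lift Aᶜ = (lift A)ᶜ
  lift_inter : ∀ {X : Type} (A B : Set X), lift (A ∩ B) = lift A ∩ lift B
  lift_preimage : ∀ {X Y : Type} (f : X → Y) (B : Set Y), lift (f ⁻¹' B) = map f ⁻¹' lift B
  lift_image : ∀ {X Y : Type} (f : X → Y) (A : Set X), lift (f '' A) = map f '' lift A
  lift_eq : ∀ {X Y : Type} (f g : X → Y), lift {x | f x = g x} = {x | map f x = map g x}
  /-- `*(X × Y)` is `*X × *Y`, through the extensions of the two projections. -/
  prod_bijective : ∀ X Y : Type, Function.Bijective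
    (fun z : Star (X × Y) => ((map Prod.fst z, map Prod.snd z) : Star X × Star Y))

namespace NonstandardExtension

/-- The element of `*(X × Y)` with components `x` and `y`. -/
noncomputable def pair (N : NonstandardExtension.{u}) {X Y : Type} (x : N.Star X) (y : N.Star Y) :
    N.Star (X × Y) :=
  (Equiv.ofBijective _ (N.prod_bijective X Y)).symm (x, y)

/-- The extension of a function of two variables. -/
noncomputable def map₂ (N : NonstandardExtension.{u}) {X Y Z : Type} (f : X → Y → Z)
    (x : N.Star X) (y : N.Star Y) : N.Star Z :=
  N.map (fun p : X × Y => f p.1 p.2) (N.pair x y)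

/-- The extension of a binary relation. -/
def Rel (N : NonstandardExtension.{u}) {X Y : Type} (r : X → Y → Prop)
    (x : N.Star X) (y : N.Star Y) : Prop :=
  N.pair x y ∈ N.lift {p : X × Y | r p.1 p.2}

/-- An element `A` of `*𝒫(X)`, viewed as an actual subset of `*X`. The sets obtained in this way
are the internal subsets of `*X`. -/
def internalSet (N : NonstandardExtension.{u}) {X : Type} (A : N.Star (Set X)) : Set (N.Star X) :=
  {x | N.Rel (fun (a : X) (B : Set X) => a ∈ B) x A}

/-- Countable (`ℵ₁`-) saturation: a sequence of internal subsets of `*X` with the finite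
intersection property has nonempty intersection. -/
def CountablySaturated (N : NonstandardExtension.{u}) : Prop :=
  ∀ (X : Type) (A : ℕ → N.Star (Set X)),
    (∀ n, (⋂ k ≤ n, N.internalSet (A k)).Nonempty) → (⋂ k, N.internalSet (A k)).Nonempty

/-- `K ∈ *ℕ` is infinite: it is larger than every standard natural number. -/
def IsInfinite (N : NonstandardExtension.{u}) (K : N.Star ℕ) : Prop :=
  ∀ n : ℕ, N.Rel (fun a b : ℕ => a < b) (N.std n) K

/-- The standard part of a finite hyperreal `r`, as the least upper bound of the standard reals
below it. (It is only applied to hyperreals between `0` and `1`.) -/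
noncomputable def st (N : NonstandardExtension.{u}) (r : N.Star ℝ) : ℝ :=
  sSup {q : ℝ | N.Rel (fun a b : ℝ => a ≤ b) (N.std q) r}

end NonstandardExtension

/-- The fair coin: the uniform probability measure on `{0, 1}`. -/
noncomputable def fairCoin : Measure Bool := (PMF.uniformOfFintype Bool).toMeasure

/-- Lebesgue measure on `2^ℕ`: the infinite product of fair coins. -/
noncomputable def cantorMeasure : Measure (ℕ → Bool) := Measure.infinitePi fun _ : ℕ => fairCoin

/-- Finite `0`-`1` sequences, each with its length; those of length `n` form `2^n`. -/
abbrev BinWord : Type := Σ n : ℕ, (Fin n → Bool)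

/-- The `j`-th entry of a finite `0`-`1` sequence (with the value `0` beyond its length). -/
def BinWord.entry (w : BinWord) (j : ℕ) : Bool :=
  if h : j < w.1 then w.2 ⟨j, h⟩ else false

/-- For standard `n`, the product measure on `2^n` of (the part in `2^n` of) a set of finite
sequences. -/
noncomputable def wordProb (n : ℕ) (A : Set BinWord) : ℝ :=
  (Measure.pi fun _ : Fin n => fairCoin).real {v : Fin n → Bool | (⟨n, v⟩ : BinWord) ∈ A}

namespace NonstandardExtension

/-- The internal set `2^K` of hyperfinite `0`-`1` sequences of length `K ∈ *ℕ`. -/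
def Cube (N : NonstandardExtension.{u}) (K : N.Star ℕ) : Type u :=
  {x : N.Star BinWord // N.map (fun w : BinWord => w.1) x = K}

/-- The internal subset of `2^K` cut out by `A`; all internal subsets of `2^K` are of this form. -/
def cubeSet (N : NonstandardExtension.{u}) (K : N.Star ℕ) (A : N.Star (Set BinWord)) :
    Set (N.Cube K) :=
  {x | x.1 ∈ N.internalSet A}

/-- The internal product measure on `2^K`, with values in `*ℝ`: the nonstandard extension, at `K`,
of the function that takes `n` to the product measure on `2^n`. -/
noncomputable def internalProb (N : NonstandardExtension.{u}) (K : N.Star ℕ)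
    (A : N.Star (Set BinWord)) : N.Star ℝ :=
  N.map₂ wordProb K A

/-- The `σ`-algebra on `2^K` generated by the internal subsets. -/
instance (N : NonstandardExtension.{u}) (K : N.Star ℕ) : MeasurableSpace (N.Cube K) :=
  MeasurableSpace.generateFrom (range (N.cubeSet K))

/-- `μ` is a Loeb measure of the internal product measure on `2^K`: a (`σ`-additive) measure on the
`σ`-algebra generated by the internal sets which extends the standard part of the internal
product measure. -/
def IsLoebMeasure (N : NonstandardExtension.{u}) (K : N.Star ℕ) (μ : Measure (N.Cube K)) : Prop :=
  ∀ A : N.Star (Set BinWord), μ (N.cubeSet K A) = ENNReal.ofReal (N.st (N.internalProb K A))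

open Classical in
/-- The restriction map `2^K → 2^ℕ`, which takes `x` to the sequence of its entries at the standard
natural numbers. -/
noncomputable def restriction (N : NonstandardExtension.{u}) (K : N.Star ℕ) (x : N.Cube K) :
    ℕ → Bool :=
  fun n => decide (N.map₂ BinWord.entry x.1 (N.std n) = N.std true)

end NonstandardExtension

/-- The open set of infinite sequences with an initial segment in `W`. -/
def openOf (W : Set (List Bool)) : Set (ℕ → Bool) :=
  {x | ∃ σ ∈ W, ∀ (i : ℕ) (h : i < σ.length), x i = σ[i]}

/-- A Martin-Löf test: a uniformly computably enumerable sequence of open sets `U 0, U 1, …` in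
`2^ℕ`, with the measure of `U n` at most `2^(-n)`. -/
def IsMartinLofTest (W : ℕ → Set (List Bool)) : Prop :=
  REPred (fun q : ℕ × List Bool => q.2 ∈ W q.1) ∧
    ∀ n : ℕ, cantorMeasure (openOf (W n)) ≤ ((2 : ENNReal) ^ n)⁻¹

/-- A sequence is Martin-Löf random if it passes every Martin-Löf test. -/
def MartinLofRandom (x : ℕ → Bool) : Prop :=
  ∀ W : ℕ → Set (List Bool), IsMartinLofTest W → ∃ n, x ∉ openOf (W n)

/-!
Every `x ∈ *X` determines an ultrafilter on `X`, its type `{A | x ∈ *A}` (`ultra`). A finite tuple of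
nonstandard elements is the image of a single element `z` under extensions of standard functions
(`exists_map_eq₃`), and an atomic statement about `*g z`, `*h z`, … holds iff the corresponding
statement about `g t`, `h t`, … holds for almost all `t` along the type of `z`. The standard part of
`*g z`, for `g` with values in `[0, 1]`, is the limit of `g` along that ultrafilter (`tendsto_st`).

Hence the internal subsets of `2^K` form an algebra, on which the standard part of the internal
product measure, as a limit of finitely additive probabilities on the cubes `2^n`, is well defined,
monotone and finitely additive. By saturation a decreasing sequence of internal sets with empty
intersection is eventually empty (`CountablySaturated.exists_eq_empty`). Thus the content is
`σ`-additive, and Carathéodory's theorem gives the Loeb measure; uniqueness is the `π`-`λ` theorem.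

The preimage of a cylinder of `2^ℕ` under restriction is the internal set given by the same
conditions on the entries (`restriction_preimage_pi`). For all large `n`, hence along the type of the
infinite number `K`, its probability in `2^n` is the measure of the cylinder, and a measure on `2^ℕ`
is determined by its values on cylinders; so the pushforward is `cantorMeasure`.

The rest concerns null sets of `2^ℕ` only: `cantorMeasure` has no atoms, and there are only countably
many partial recursive functions, hence countably many computable sequences and countably many
Martin-Löf tests, each of which covers a null set.
-/

open Filter Topology

namespace NonstandardExtension

variable (N : NonstandardExtension.{u}) {X Y Z : Type}

/-! ### The ultrafilter of a nonstandard element -/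

theorem lift_empty : N.lift (∅ : Set X) = ∅ := by
  have h := N.lift_inter (∅ : Set X) ∅ᶜ
  rwa [Set.inter_compl_self, N.lift_compl, Set.inter_compl_self] at h

theorem lift_univ : N.lift (univ : Set X) = univ := by
  rw [← compl_empty, N.lift_compl, N.lift_empty, compl_empty]

theorem lift_mono {A B : Set X} (h : A ⊆ B) : N.lift A ⊆ N.lift B := by
  rw [← Set.inter_eq_left.2 h, N.lift_inter]
  exact Set.inter_subset_right

/-- The type of `x ∈ *X`: the ultrafilter of those `A ⊆ X` for which `x ∈ *A`. -/
def ultra (x : N.Star X) : Ultrafilter X :=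
  Ultrafilter.ofComplNotMemIff
    { sets := {A | x ∈ N.lift A}
      univ_sets := by simp [N.lift_univ]
      sets_of_superset := fun hA hAB => N.lift_mono hAB hA
      inter_sets := fun {A B} hA hB => by
        change x ∈ N.lift (A ∩ B)
        rw [N.lift_inter]
        exact ⟨hA, hB⟩ }
    (fun A => by
      change x ∉ N.lift Aᶜ ↔ x ∈ N.lift A
      simp [N.lift_compl])

variable {N}

theorem eventually_ultra {x : N.Star X} {p : X → Prop} :
    (∀ᶠ t in N.ultra x, p t) ↔ x ∈ N.lift {t | p t} := Iff.rfl

theorem map_eq_map_iff {z : N.Star X} {f g : X → Y} :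
    N.map f z = N.map g z ↔ ∀ᶠ t in N.ultra z, f t = g t := by
  rw [eventually_ultra, N.lift_eq, mem_ofPred_eq]

/-- Transfer of existential quantification: if `∃ y, r y t` holds for almost every `t` in the sense
of `z`, there is a nonstandard witness `y`, given here together with `z` as the pair `w`. -/
theorem exists_of_eventually_exists {z : N.Star X} {r : Y → X → Prop}
    (h : ∀ᶠ t in N.ultra z, ∃ y, r y t) :
    ∃ w : N.Star (Y × X), N.map Prod.snd w = z ∧ ∀ᶠ p : Y × X in N.ultra w, r p.1 p.2 := by
  have hS : {t | ∃ y, r y t} = Prod.snd '' {p : Y × X | r p.1 p.2} := by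
    ext t
    simp
  rw [eventually_ultra, hS, N.lift_image] at h
  obtain ⟨w, hw, rfl⟩ := h
  exact ⟨w, rfl, hw⟩

/-- A constant function extends to a constant function, because `*Unit` has only one element. -/
theorem map_const (c : Y) (x : N.Star X) : N.map (fun _ => c) x = N.std c := by
  have hu : ∀ a b : N.Star Unit, a = b := fun a b => by
    obtain ⟨z, hz⟩ := (N.prod_bijective Unit Unit).2 (a, b)
    simp only [Prod.mk.injEq] at hz
    -- The two projections `Unit × Unit → Unit` are equal by definition.
    rw [← hz.1, ← hz.2]
  have h := N.map_comp (fun _ : Unit => c) (fun _ : X => ()) x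
  rw [hu (N.map (fun _ : X => ()) x) (N.std ()), N.map_std] at h
  exact h

theorem map_map (g : Y → Z) (f : X → Y) (x : N.Star X) :
    N.map g (N.map f x) = N.map (fun t => g (f t)) x :=
  (N.map_comp g f x).symm

theorem exists_map_fst_snd (x : N.Star X) (y : N.Star Y) :
    ∃ z : N.Star (X × Y), N.map Prod.fst z = x ∧ N.map Prod.snd z = y := by
  obtain ⟨z, hz⟩ := (N.prod_bijective X Y).2 (x, y)
  simp only [Prod.mk.injEq] at hz
  exact ⟨z, hz⟩

/-- Finitely many nonstandard elements are the images of a single one under extensions of standard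
functions. First-order statements about them are thereby statements about one ultrafilter. -/
theorem exists_map_eq₃ (x : N.Star X) (y : N.Star Y) (z : N.Star Z) :
    ∃ w : N.Star (X × Y × Z), N.map (fun p => p.1) w = x ∧ N.map (fun p => p.2.1) w = y ∧
      N.map (fun p => p.2.2) w = z := by
  obtain ⟨v, rfl, rfl⟩ := N.exists_map_fst_snd y z
  obtain ⟨w, rfl, rfl⟩ := N.exists_map_fst_snd x v
  exact ⟨w, rfl, (map_map _ _ _).symm, (map_map _ _ _).symm⟩

theorem pair_map (g : X → Y) (h : X → Z) (z : N.Star X) :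
    N.pair (N.map g z) (N.map h z) = N.map (fun t => (g t, h t)) z := by
  rw [pair, Equiv.symm_apply_eq]
  simp [map_map]

theorem map₂_map {W : Type} (f : Y → Z → W) (g : X → Y) (h : X → Z) (z : N.Star X) :
    N.map₂ f (N.map g z) (N.map h z) = N.map (fun t => f (g t) (h t)) z := by
  rw [map₂, pair_map, map_map]

theorem rel_map {r : Y → Z → Prop} {g : X → Y} {h : X → Z} {z : N.Star X} :
    N.Rel r (N.map g z) (N.map h z) ↔ ∀ᶠ t in N.ultra z, r (g t) (h t) := by
  rw [Rel, pair_map, eventually_ultra, ← mem_preimage, ← N.lift_preimage]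
  rfl

theorem mem_internalSet_map {g : X → Y} {a : X → Set Y} {z : N.Star X} :
    N.map g z ∈ N.internalSet (N.map a z) ↔ ∀ᶠ t in N.ultra z, g t ∈ a t := by
  rw [internalSet, mem_ofPred_eq, rel_map]

theorem mem_internalSet_std {x : N.Star X} {A : Set X} :
    x ∈ N.internalSet (N.std A) ↔ A ∈ N.ultra x := by
  have h := mem_internalSet_map (g := id) (a := fun _ => A) (z := x)
  rwa [N.map_id, map_const] at h

theorem internalSet_compl (A : N.Star (Set X)) :
    N.internalSet (N.map compl A) = (N.internalSet A)ᶜ := by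
  ext x
  obtain ⟨z, rfl, rfl⟩ := N.exists_map_fst_snd x A
  rw [map_map, mem_compl_iff, mem_internalSet_map, mem_internalSet_map]
  exact Ultrafilter.eventually_not

theorem internalSet_union (A B : N.Star (Set X)) :
    N.internalSet (N.map₂ (· ∪ ·) A B) = N.internalSet A ∪ N.internalSet B := by
  ext x
  obtain ⟨z, rfl, rfl, rfl⟩ := N.exists_map_eq₃ x A B
  rw [map₂_map, mem_union, mem_internalSet_map, mem_internalSet_map, mem_internalSet_map]
  exact Ultrafilter.eventually_or

/-- The fibre of `*f` over any `y ∈ *Y`, standard or not, meets an internal set in an internal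
set. -/
theorem mem_internalSet_fibre (f : X → Y) {x : N.Star X} {y : N.Star Y} {A : N.Star (Set X)} :
    x ∈ N.internalSet (N.map₂ (fun (b : Y) (C : Set X) => {a | f a = b ∧ a ∈ C}) y A) ↔
      N.map f x = y ∧ x ∈ N.internalSet A := by
  obtain ⟨z, rfl, rfl, rfl⟩ := N.exists_map_eq₃ x y A
  rw [map₂_map, map_map, map_eq_map_iff, mem_internalSet_map, mem_internalSet_map,
    ← eventually_and]
  rfl

theorem IsInfinite.eventually_lt {K : N.Star ℕ} (hK : N.IsInfinite K) (n : ℕ) :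
    ∀ᶠ m in N.ultra K, n < m := by
  have h := hK n
  rwa [← map_const n K, ← N.map_id K, map_const, ← map_const n K, rel_map] at h

/-! ### Standard parts as limits -/

/-- The standard part of the value at `z` of the extension of a function `g` with values in `[0, 1]`
is the limit of `g` along the ultrafilter of `z`. -/
theorem tendsto_st {g : X → ℝ} (hg : ∀ t, g t ∈ Icc (0 : ℝ) 1) (z : N.Star X) :
    Tendsto g (N.ultra z) (𝓝 (N.st (N.map g z))) := by
  obtain ⟨l, -, hl⟩ := isCompact_Icc.ultrafilter_le_nhds ((N.ultra z).map g)
    (le_principal_iff.2 (Eventually.of_forall hg : ∀ᶠ t in N.ultra z, g t ∈ Icc (0 : ℝ) 1))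
  have hl : Tendsto g (N.ultra z) (𝓝 l) := hl
  have hlub : IsLUB {q : ℝ | N.Rel (fun a b : ℝ => a ≤ b) (N.std q) (N.map g z)} l := by
    simp only [← map_const _ z, rel_map]
    refine ⟨fun q hq => ge_of_tendsto hl hq, fun b hb => le_of_forall_lt fun q hq => ?_⟩
    -- A real strictly between `q` and the limit is eventually below `g`, hence at most `b`.
    obtain ⟨q', hq', hq'l⟩ := exists_between hq
    exact hq'.trans_le (hb ((hl.eventually_const_lt hq'l).mono fun _ ht => ht.le))
  have hne : {q : ℝ | N.Rel (fun a b : ℝ => a ≤ b) (N.std q) (N.map g z)}.Nonempty := by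
    refine ⟨0, ?_⟩
    rw [mem_ofPred_eq, ← map_const _ z, rel_map]
    exact Eventually.of_forall fun t => (hg t).1
  rwa [st, hlub.csSup_eq hne]

/-! ### The algebra of internal subsets of the cube -/

variable {K : N.Star ℕ}

theorem mem_cubeSet {x : N.Cube K} {A : N.Star (Set BinWord)} :
    x ∈ N.cubeSet K A ↔ x.1 ∈ N.internalSet A := Iff.rfl

theorem cubeSet_compl (A : N.Star (Set BinWord)) :
    N.cubeSet K (N.map compl A) = (N.cubeSet K A)ᶜ := by
  ext x
  rw [mem_compl_iff, mem_cubeSet, mem_cubeSet, internalSet_compl, mem_compl_iff]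

theorem cubeSet_union (A B : N.Star (Set BinWord)) :
    N.cubeSet K (N.map₂ (· ∪ ·) A B) = N.cubeSet K A ∪ N.cubeSet K B := by
  ext x
  rw [mem_union, mem_cubeSet, mem_cubeSet, mem_cubeSet, internalSet_union, mem_union]

theorem mem_cubeSet_std {x : N.Cube K} {A : Set BinWord} :
    x ∈ N.cubeSet K (N.std A) ↔ ∀ᶠ w in N.ultra x.1, w ∈ A :=
  mem_cubeSet.trans mem_internalSet_std

theorem cubeSet_std_univ : N.cubeSet K (N.std univ) = univ :=
  eq_univ_of_forall fun _ => mem_cubeSet_std.2 (Eventually.of_forall fun _ => trivial)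

theorem cubeSet_std_empty : N.cubeSet K (N.std ∅) = ∅ :=
  eq_empty_of_forall_notMem fun _ hx => (mem_cubeSet_std.1 hx).exists.choose_spec

theorem isSetAlgebra_range_cubeSet : IsSetAlgebra (range (N.cubeSet K)) where
  empty_mem := ⟨_, cubeSet_std_empty⟩
  compl_mem := by
    rintro _ ⟨A, rfl⟩
    exact ⟨_, cubeSet_compl A⟩
  union_mem := by
    rintro _ _ ⟨A, rfl⟩ ⟨B, rfl⟩
    exact ⟨_, cubeSet_union A B⟩

/-- Transfer of inclusion: an inclusion between internal subsets of `2^K` holds for almost all of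
the standard sets that represent them. -/
theorem eventually_of_cubeSet_subset {k : X → ℕ} {a b : X → Set BinWord} {z : N.Star X}
    (h : N.cubeSet (N.map k z) (N.map a z) ⊆ N.cubeSet (N.map k z) (N.map b z)) :
    ∀ᶠ t in N.ultra z, ∀ w ∈ a t, w.1 = k t → w ∈ b t := by
  by_contra hcon
  have hex : ∀ᶠ t in N.ultra z, ∃ w, w ∈ a t ∧ w.1 = k t ∧ w ∉ b t := by
    refine (Ultrafilter.eventually_not.2 hcon).mono fun t ht => ?_
    push Not at ht
    exact ht
  obtain ⟨w, rfl, hw⟩ := exists_of_eventually_exists hex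
  simp only [map_map] at h
  have hmem := @h ⟨N.map Prod.fst w, by
    rw [map_map, map_map k, map_eq_map_iff]
    exact hw.mono fun p hp => hp.2.1⟩ (mem_internalSet_map.2 (hw.mono fun p hp => hp.1))
  obtain ⟨p, hp, hp'⟩ := (hw.and (mem_internalSet_map.1 hmem)).exists
  exact hp.2.2 hp'

/-- By saturation the cube is countably compact with respect to its internal subsets: a
decreasing sequence of them with empty intersection is eventually empty. -/
theorem CountablySaturated.exists_eq_empty (hN : N.CountablySaturated) {s : ℕ → Set (N.Cube K)}
    (hs : ∀ n, s n ∈ range (N.cubeSet K)) (hanti : Antitone s) (hempty : ⋂ n, s n = ∅) :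
    ∃ n, s n = ∅ := by
  choose A hA using hs
  -- `B n` is the image of `s n` in the ambient set of all hyperfinite words.
  let B : ℕ → N.Star (Set BinWord) := fun n =>
    N.map₂ (fun (k : ℕ) (C : Set BinWord) => {w | w.1 = k ∧ w ∈ C}) K (A n)
  have hB : ∀ n x, x ∈ N.internalSet (B n) ↔
      N.map (fun w : BinWord => w.1) x = K ∧ x ∈ N.internalSet (A n) :=
    fun _ _ => mem_internalSet_fibre _
  by_contra! hne
  obtain ⟨x, hx⟩ := hN BinWord B fun n => by
    obtain ⟨x, hx⟩ := hne n
    refine ⟨x.1, mem_iInter₂.2 fun k hk => (hB k _).2 ⟨x.2, mem_cubeSet.1 ?_⟩⟩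
    exact hA k ▸ hanti hk hx
  rw [mem_iInter] at hx
  have hmem : (⟨x, ((hB 0 x).1 (hx 0)).1⟩ : N.Cube K) ∈ ⋂ n, s n :=
    mem_iInter.2 fun n => hA n ▸ mem_cubeSet.2 ((hB n x).1 (hx n)).2
  rw [hempty] at hmem
  exact hmem

end NonstandardExtension

/-! ### The Loeb measure -/

instance : IsProbabilityMeasure fairCoin :=
  inferInstanceAs (IsProbabilityMeasure (PMF.uniformOfFintype Bool).toMeasure)

theorem wordProb_mem_Icc (n : ℕ) (A : Set BinWord) : wordProb n A ∈ Icc (0 : ℝ) 1 :=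
  ⟨measureReal_nonneg, measureReal_le_one⟩

theorem wordProb_mono {n : ℕ} {A B : Set BinWord} (h : ∀ w ∈ A, w.1 = n → w ∈ B) :
    wordProb n A ≤ wordProb n B :=
  measureReal_mono fun _ hv => h _ hv rfl

theorem wordProb_union {n : ℕ} {A B : Set BinWord} (h : ∀ w ∈ A, w.1 = n → w ∉ B) :
    wordProb n (A ∪ B) = wordProb n A + wordProb n B :=
  measureReal_union (disjoint_left.2 fun _ hv => h _ hv rfl) (toFinite _).measurableSet

namespace NonstandardExtension

variable {N : NonstandardExtension.{u}} {K : N.Star ℕ}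

/-- The standard part of the internal measure is a limit of measures on standard cubes `2^n`. -/
theorem tendsto_wordProb {X : Type} (k : X → ℕ) (a : X → Set BinWord) (z : N.Star X) :
    Tendsto (fun t => wordProb (k t) (a t)) (N.ultra z)
      (𝓝 (N.st (N.internalProb (N.map k z) (N.map a z)))) := by
  rw [internalProb, map₂_map]
  exact tendsto_st (fun t => wordProb_mem_Icc _ _) z

theorem tendsto_wordProb_std (A : Set BinWord) :
    Tendsto (fun n => wordProb n A) (N.ultra K) (𝓝 (N.st (N.internalProb K (N.std A)))) := by
  have h := tendsto_wordProb id (fun _ => A) K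
  rwa [N.map_id, map_const] at h

theorem st_internalProb_nonneg (A : N.Star (Set BinWord)) : 0 ≤ N.st (N.internalProb K A) := by
  obtain ⟨z, rfl, rfl⟩ := N.exists_map_fst_snd K A
  exact ge_of_tendsto' (tendsto_wordProb _ _ z) fun _ => (wordProb_mem_Icc _ _).1

/-- The standard part of the internal measure is monotone in the subset of `2^K`; in particular it
does not depend on the internal set of words that represents this subset. -/
theorem st_internalProb_mono {A B : N.Star (Set BinWord)} (h : N.cubeSet K A ⊆ N.cubeSet K B) :
    N.st (N.internalProb K A) ≤ N.st (N.internalProb K B) := by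
  obtain ⟨z, rfl, rfl, rfl⟩ := N.exists_map_eq₃ K A B
  exact le_of_tendsto_of_tendsto (tendsto_wordProb _ _ z) (tendsto_wordProb _ _ z)
    ((eventually_of_cubeSet_subset h).mono fun _ => wordProb_mono)

theorem st_internalProb_union {A B : N.Star (Set BinWord)}
    (h : Disjoint (N.cubeSet K A) (N.cubeSet K B)) :
    N.st (N.internalProb K (N.map₂ (· ∪ ·) A B)) =
      N.st (N.internalProb K A) + N.st (N.internalProb K B) := by
  rw [← subset_compl_iff_disjoint_right, ← cubeSet_compl] at h
  obtain ⟨z, rfl, rfl, rfl⟩ := N.exists_map_eq₃ K A B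
  rw [map_map] at h
  rw [map₂_map]
  refine tendsto_nhds_unique (tendsto_wordProb _ _ z)
    (((tendsto_wordProb _ _ z).add (tendsto_wordProb _ _ z)).congr' ?_)
  filter_upwards [eventually_of_cubeSet_subset h] with t ht
  exact (wordProb_union ht).symm

theorem st_internalProb_std_of_eventually {A : Set BinWord} {c : ℝ}
    (h : ∀ᶠ n in N.ultra K, wordProb n A = c) : N.st (N.internalProb K (N.std A)) = c :=
  tendsto_nhds_unique (tendsto_wordProb_std A)
    (tendsto_const_nhds.congr' (h.mono fun _ hn => hn.symm))

variable (N K) in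
/-- The Loeb outer approximation of a subset of `2^K`: the infimum of the standard parts of the
internal measures of the internal sets that contain it. -/
noncomputable def loebOuter (s : Set (N.Cube K)) : ENNReal :=
  ⨅ (A : N.Star (Set BinWord)) (_ : s ⊆ N.cubeSet K A), ENNReal.ofReal (N.st (N.internalProb K A))

theorem loebOuter_cubeSet (A : N.Star (Set BinWord)) :
    N.loebOuter K (N.cubeSet K A) = ENNReal.ofReal (N.st (N.internalProb K A)) :=
  le_antisymm (iInf₂_le A Subset.rfl)
    (le_iInf₂ fun _ hB => ENNReal.ofReal_le_ofReal (st_internalProb_mono hB))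

theorem loebOuter_empty : N.loebOuter K ∅ = 0 := by
  rw [← cubeSet_std_empty, loebOuter_cubeSet,
    st_internalProb_std_of_eventually (c := 0) (Eventually.of_forall fun n => by simp [wordProb]),
    ENNReal.ofReal_zero]

theorem loebOuter_union {s t : Set (N.Cube K)} (hs : s ∈ range (N.cubeSet K))
    (ht : t ∈ range (N.cubeSet K)) (h : Disjoint s t) :
    N.loebOuter K (s ∪ t) = N.loebOuter K s + N.loebOuter K t := by
  obtain ⟨A, rfl⟩ := hs
  obtain ⟨B, rfl⟩ := ht
  rw [← cubeSet_union, loebOuter_cubeSet, loebOuter_cubeSet, loebOuter_cubeSet,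
    st_internalProb_union h,
    ENNReal.ofReal_add (st_internalProb_nonneg A) (st_internalProb_nonneg B)]

variable (N K) in
/-- The finitely additive content on the algebra of internal subsets of `2^K` given by the standard
part of the internal product measure. -/
noncomputable def loebContent : AddContent ENNReal (range (N.cubeSet K)) :=
  isSetAlgebra_range_cubeSet.isSetRing.addContent_of_union (N.loebOuter K) loebOuter_empty
    (fun hs ht h => loebOuter_union hs ht h)

theorem loebContent_cubeSet (A : N.Star (Set BinWord)) :
    N.loebContent K (N.cubeSet K A) = ENNReal.ofReal (N.st (N.internalProb K A)) :=
  loebOuter_cubeSet A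

/-- The content is `σ`-additive because saturation makes its continuity at `∅` trivial. -/
theorem CountablySaturated.isSigmaSubadditive_loebContent (hN : N.CountablySaturated) :
    (N.loebContent K).IsSigmaSubadditive := by
  refine isSigmaSubadditive_of_addContent_iUnion_eq_tsum isSetAlgebra_range_cubeSet.isSetRing
    fun f hf hU hd => addContent_iUnion_eq_sum_of_tendsto_zero
      isSetAlgebra_range_cubeSet.isSetRing (N.loebContent K) ?_ ?_ hf hU hd
  · rintro _ ⟨A, rfl⟩
    rw [loebContent_cubeSet]
    exact ENNReal.ofReal_ne_top
  · intro s hs hanti hempty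
    obtain ⟨n, hn⟩ := hN.exists_eq_empty hs hanti hempty
    refine tendsto_const_nhds.congr' ?_
    filter_upwards [eventually_ge_atTop n] with m hm
    rw [subset_empty_iff.1 ((hanti hm).trans hn.subset), addContent_empty]

theorem CountablySaturated.exists_isLoebMeasure (hN : N.CountablySaturated) (K : N.Star ℕ) :
    ∃ μ : Measure (N.Cube K), N.IsLoebMeasure K μ := by
  refine ⟨(N.loebContent K).measure isSetAlgebra_range_cubeSet.isSetRing.isSetSemiring le_rfl
    hN.isSigmaSubadditive_loebContent, fun A => ?_⟩
  rw [AddContent.measure_eq _ _ rfl _ (mem_range_self A), loebContent_cubeSet]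

theorem IsLoebMeasure.isProbabilityMeasure {μ : Measure (N.Cube K)} (hμ : N.IsLoebMeasure K μ) :
    IsProbabilityMeasure μ := by
  constructor
  rw [← cubeSet_std_univ, hμ,
    st_internalProb_std_of_eventually (c := 1) (Eventually.of_forall fun n => by simp [wordProb]),
    ENNReal.ofReal_one]

theorem IsLoebMeasure.unique {μ ν : Measure (N.Cube K)} (hμ : N.IsLoebMeasure K μ)
    (hν : N.IsLoebMeasure K ν) : μ = ν := by
  have := hμ.isProbabilityMeasure
  have := hν.isProbabilityMeasure
  refine ext_of_generate_finite _ rfl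
    isSetAlgebra_range_cubeSet.isSetRing.isSetSemiring.isPiSystem ?_ (by simp)
  rintro _ ⟨A, rfl⟩
  rw [hμ, hν]

/-! ### The pushforward to the Cantor space -/

/-- As `Bool` is finite, the `n`-th entry takes a constant value along the ultrafilter of `x`; the
restriction of `x` picks out this value. -/
theorem restriction_mem_iff {x : N.Cube K} {n : ℕ} {T : Set Bool} :
    N.restriction K x n ∈ T ↔ ∀ᶠ w : BinWord in N.ultra x.1, w.entry n ∈ T := by
  have hmap : N.map₂ BinWord.entry x.1 (N.std n) = N.map (fun w : BinWord => w.entry n) x.1 := by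
    have h := map₂_map BinWord.entry id (fun _ => n) x.1
    rwa [N.map_id, map_const] at h
  have htrue : N.restriction K x n = true ↔ ∀ᶠ w : BinWord in N.ultra x.1, w.entry n = true := by
    classical
    rw [restriction, decide_eq_true_iff, hmap, ← map_const true x.1, map_eq_map_iff]
  have heq : ∀ᶠ w : BinWord in N.ultra x.1, w.entry n = N.restriction K x n := by
    cases hb : N.restriction K x n with
    | true => exact htrue.1 hb
    | false =>
      refine (Ultrafilter.eventually_not.2 (mt htrue.2 (by simp [hb]))).mono fun w hw => ?_
      simpa using hw
  rw [eventually_congr (heq.mono fun w hw => by rw [hw]), eventually_const]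

/-- The preimage of a cylinder is internal: it is the part in `2^K` of the extension of a standard
set of finite words. -/
theorem restriction_preimage_pi (s : Finset ℕ) (t : ℕ → Set Bool) :
    N.restriction K ⁻¹' (s : Set ℕ).pi t =
      N.cubeSet K (N.std {w | ∀ i ∈ s, w.entry i ∈ t i}) := by
  ext x
  rw [mem_cubeSet_std, mem_preimage, Set.mem_pi]
  simp only [Finset.mem_coe, restriction_mem_iff, mem_ofPred_eq]
  exact (eventually_all_finset s).symm

theorem measurable_restriction : Measurable (N.restriction K) := by
  refine measurable_pi_iff.2 fun n T _ => ?_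
  have h := restriction_preimage_pi (K := K) {n} fun _ => T
  simp only [Finset.coe_singleton, singleton_pi] at h
  exact h ▸ MeasurableSpace.measurableSet_generateFrom (mem_range_self _)

end NonstandardExtension

/-- Cylinder conditions on entries below `n` have the same probability in `2^n` as in `2^ℕ`. -/
theorem wordProb_entry_mem {n : ℕ} (s : Finset ℕ) (hs : ∀ i ∈ s, i < n) (t : ℕ → Set Bool) :
    wordProb n {w | ∀ i ∈ s, w.entry i ∈ t i} = (∏ i ∈ s, fairCoin (t i)).toReal := by
  have hset : {v : Fin n → Bool | (⟨n, v⟩ : BinWord) ∈ {w | ∀ i ∈ s, BinWord.entry w i ∈ t i}} =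
      univ.pi fun j : Fin n => if (j : ℕ) ∈ s then t j else univ := by
    ext v
    simp only [mem_ofPred_eq, Set.mem_pi, mem_univ, true_imp_iff]
    refine ⟨fun h j => ?_, fun h i hi => ?_⟩
    · split_ifs with hj
      · simpa [BinWord.entry] using h j hj
      · trivial
    · simpa [BinWord.entry, hs i hi, hi] using h ⟨i, hs i hi⟩
  rw [wordProb, hset, Measure.real, Measure.pi_pi,
    Fin.prod_univ_eq_prod_range (fun j => fairCoin (if j ∈ s then t j else univ)) n]
  congr 1
  rw [← Finset.prod_subset (s₁ := s) (fun i hi => Finset.mem_range.2 (hs i hi))]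
  · exact Finset.prod_congr rfl fun i hi => by rw [if_pos hi]
  · intro i _ hi
    rw [if_neg hi, measure_univ]

namespace NonstandardExtension

variable {N : NonstandardExtension.{u}} {K : N.Star ℕ}

theorem IsLoebMeasure.map_restriction (hK : N.IsInfinite K) {μ : Measure (N.Cube K)}
    (hμ : N.IsLoebMeasure K μ) : μ.map (N.restriction K) = cantorMeasure := by
  refine Measure.eq_infinitePi _ fun s t ht => ?_
  rw [Measure.map_apply measurable_restriction (.pi s.countable_toSet fun i _ => ht i),
    restriction_preimage_pi, hμ, st_internalProb_std_of_eventually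
      (c := (∏ i ∈ s, fairCoin (t i)).toReal), ENNReal.ofReal_toReal]
  · exact ENNReal.prod_ne_top fun i _ => measure_ne_top _ _
  · filter_upwards [hK.eventually_lt (s.sup id)] with n hn
    exact wordProb_entry_mem s (fun i hi => (Finset.le_sup (f := id) hi).trans_lt hn) t

end NonstandardExtension

/-! ### Null sets of the Cantor space -/

theorem fairCoin_singleton (b : Bool) : fairCoin {b} = 2⁻¹ := by
  simp [fairCoin]

instance : IsProbabilityMeasure cantorMeasure :=
  inferInstanceAs (IsProbabilityMeasure (Measure.infinitePi fun _ : ℕ => fairCoin))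

instance : NullSingletonClass cantorMeasure where
  measure_singleton x := by
    refine le_antisymm (ge_of_tendsto' (ENNReal.tendsto_pow_atTop_nhds_zero_of_lt_one
      (r := 2⁻¹) (by simp)) fun n => ?_) zero_le
    calc cantorMeasure {x}
        ≤ cantorMeasure (((Finset.range n : Finset ℕ) : Set ℕ).pi fun i => {x i}) :=
          measure_mono (singleton_subset_iff.2 fun i _ => rfl)
      _ = 2⁻¹ ^ n := by
          rw [cantorMeasure, Measure.infinitePi_pi _ fun i _ => measurableSet_singleton _]
          simp [fairCoin_singleton]

/-- A partial recursive function is determined by a code, of which there are countably many. -/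
theorem countable_setOf_partrec (α σ : Type*) [Primcodable α] [Primcodable σ] :
    {f : α →. σ | Partrec f}.Countable := by
  have hcode : {g : ℕ →. ℕ | Nat.Partrec g}.Countable := by
    refine (countable_range Nat.Partrec.Code.eval).mono fun g hg => ?_
    exact Nat.Partrec.Code.exists_code.1 hg
  refine hcode.preimage_of_injOn (f := fun (f : α →. σ) n =>
    Part.bind (Encodable.decode (α := α) n) fun a => (f a).map Encodable.encode) ?_
  intro f _ g _ hfg
  funext a
  have h := congrFun hfg (Encodable.encode a)
  simp only [Encodable.encodek, Part.coe_some, Part.bind_some] at h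
  ext b
  have hb := Part.ext_iff.1 h (Encodable.encode b)
  simpa [Part.mem_map_iff] using hb

theorem countable_setOf_computable : {y : ℕ → Bool | Computable y}.Countable :=
  (countable_setOf_partrec ℕ Bool).preimage_of_injOn (f := fun y : ℕ → Bool => (y : ℕ →. Bool))
    fun _ _ _ _ h => funext fun n => Part.some_injective (congrFun h n)

theorem countable_setOf_isMartinLofTest :
    {W : ℕ → Set (List Bool) | IsMartinLofTest W}.Countable := by
  refine Countable.mono (fun W hW => hW.1)
    ((countable_setOf_partrec (ℕ × List Bool) Unit).preimage_of_injOn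
      (f := fun (W : ℕ → Set (List Bool)) (q : ℕ × List Bool) =>
        Part.assert (q.2 ∈ W q.1) fun _ => Part.some ()) ?_)
  intro V _ W _ h
  funext n
  ext σ
  have hq := Part.ext_iff.1 (congrFun h (n, σ)) ()
  simpa [Part.mem_assert_iff] using hq

theorem IsMartinLofTest.measure_iInter_eq_zero {W : ℕ → Set (List Bool)} (hW : IsMartinLofTest W) :
    cantorMeasure (⋂ n, openOf (W n)) = 0 := by
  refine le_antisymm (ge_of_tendsto' (ENNReal.tendsto_pow_atTop_nhds_zero_of_lt_one
    (r := 2⁻¹) (by simp)) fun n => ?_) zero_le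
  rw [← ENNReal.inv_pow]
  exact (measure_mono (iInter_subset _ n)).trans (hW.2 n)

/-- There are only countably many Martin-Löf tests, so a union of null sets suffices and no universal
test is needed. -/
theorem cantorMeasure_setOf_not_martinLofRandom :
    cantorMeasure {y : ℕ → Bool | ¬ MartinLofRandom y} = 0 := by
  refine measure_mono_null (t := ⋃ W ∈ {W | IsMartinLofTest W}, ⋂ n, openOf (W n)) ?_
    ((measure_biUnion_null_iff countable_setOf_isMartinLofTest).2
      fun W hW => IsMartinLofTest.measure_iInter_eq_zero hW)
  intro y hy
  simpa [MartinLofRandom] using hy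

theorem mainTheorem2 (N : NonstandardExtension.{u}) (hN : N.CountablySaturated)
    (K : N.Star ℕ) (hK : N.IsInfinite K) :
    ∃ μL : Measure (N.Cube K),
      -- `μL` is the Loeb measure of the internal product measure on `2^K`
      N.IsLoebMeasure K μL ∧ (∀ ν : Measure (N.Cube K), N.IsLoebMeasure K ν → ν = μL) ∧
      IsProbabilityMeasure μL ∧
      -- its pushforward along the restriction map is the infinite product measure
      Measurable (N.restriction K) ∧ μL.map (N.restriction K) = cantorMeasure ∧
      -- hence almost every branch avoids any null set
      (∀ E : Set (ℕ → Bool), cantorMeasure E = 0 →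
        μL (N.restriction K ⁻¹' E) = 0 ∧ ∀ᵐ x ∂μL, N.restriction K x ∉ E) ∧
      -- in particular any countable set
      (∀ E : Set (ℕ → Bool), E.Countable →
        cantorMeasure E = 0 ∧ ∀ᵐ x ∂μL, N.restriction K x ∉ E) ∧
      -- such as the set of sequences that follow a computable rule
      ({y : ℕ → Bool | Computable y}.Countable ∧
        ∀ᵐ x ∂μL, ¬ Computable (N.restriction K x)) ∧
      -- and the null set of sequences that are not Martin-Löf random
      (cantorMeasure {y : ℕ → Bool | ¬ MartinLofRandom y} = 0 ∧
        ∀ᵐ x ∂μL, MartinLofRandom (N.restriction K x)) := by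
  obtain ⟨μ, hμ⟩ := hN.exists_isLoebMeasure K
  have hmeas : Measurable (N.restriction K) := NonstandardExtension.measurable_restriction
  have hmap := hμ.map_restriction hK
  have hnull : ∀ E : Set (ℕ → Bool), cantorMeasure E = 0 → μ (N.restriction K ⁻¹' E) = 0 :=
    fun E hE => Measure.preimage_null_of_map_null hmeas.aemeasurable (hmap ▸ hE)
  have hae : ∀ E : Set (ℕ → Bool), cantorMeasure E = 0 → ∀ᵐ x ∂μ, N.restriction K x ∉ E :=
    fun E hE => measure_eq_zero_iff_ae_notMem.1 (hnull E hE)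
  refine ⟨μ, hμ, fun ν hν => hν.unique hμ, hμ.isProbabilityMeasure, hmeas, hmap,
    fun E hE => ⟨hnull E hE, hae E hE⟩, fun E hE => ⟨hE.measure_zero _, hae E (hE.measure_zero _)⟩,
    ⟨countable_setOf_computable, hae _ (countable_setOf_computable.measure_zero _)⟩,
    cantorMeasure_setOf_not_martinLofRandom, ?_⟩
  filter_upwards [hae _ cantorMeasure_setOf_not_martinLofRandom] with x hx
  exact not_not.1 hx
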